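/- Let $n \ge 1$, let $K \subseteq \mathbb{R}^n$ be compact and let $r > 0$. Write $d_K(x) = \min_{y \in K} \|x-y\|$ (Euclidean norm) and $\partial K^r = \{x \in \mathbb{R}^n : d_K(x) = r\}$, which is the boundary of the open tube $K^r = \{x : d_K(x) < r\}$ (if $K=\emptyset$, both sets are empty). Then $\partial K^r$ is $\mathcal{H}^{n-1}$-rectifiable: it is $\mathcal{H}^{n-1}$-measurable, $\mathcal{H}^{n-1}(\partial K^r) < \infty$, and there are countably many Lipschitz maps $f_i : \mathbb{R}^{n-1} \to \mathbb{R}^n$ with $\mathcal{H}^{n-1}\bigl(\partial K^r \setminus \bigcup_i f_i(\mathbb{R}^{n-1})\bigr) = 0$. Moreover, if $n \ge 2$, $$\mathcal{H}^{n-1}(\partial K^r) \le \mathcal{N}(\partial K, r)\,\omega_{n-1}(2r),$$ where $\partial K$ is the topological boundary of $K$, $\mathcal{N}(\partial K, r)$ is the minimal number of closed balls of radius $r$ (with centers anywhere in $\mathbb{R}^n$) needed to cover $\partial K$, and $\omega_{n-1}(\rho)$ is the $(n-1)$-dimensional Hausdorff measure of the $(n-1)$-sphere of radius $\rho$ in $\mathbb{R}^n$.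 Here $\mathcal{H}^m$ is the $m$-dimensional Hausdorff measure, normalised to agree with Lebesgue measure on $\mathbb{R}^m$. -/

import Mathlib

open MeasureTheory
open scoped ENNReal NNReal

/-- `ω_m(r)`: the `m`-dimensional Hausdorff measure of the `m`-dimensional sphere of radius `r`,
that is, of the sphere of radius `r` in `ℝ^(m+1)`. The measure `μHE[m]` is the `m`-dimensional
Hausdorff measure normalised so that it is Lebesgue measure on `ℝ^m`. -/
noncomputable def sphereArea (m : ℕ) (r : ℝ) : ℝ≥0∞ :=
  μHE[m] (Metric.sphere (0 : EuclideanSpace ℝ (Fin (m + 1))) r)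

/-- A subset `S` of `ℝ^n` is `H^m`-rectifiable: it is `H^m`-measurable, has finite `H^m` measure,
and `H^m`-almost all of it is covered by the images of countably many Lipschitz maps
`ℝ^m → ℝ^n`. -/
structure IsHausdorffRectifiable {n : ℕ} (m : ℕ) (S : Set (EuclideanSpace ℝ (Fin n))) : Prop where
  nullMeasurableSet : NullMeasurableSet S μHE[m]
  measure_lt_top : μHE[m] S < ∞
  exists_lipschitz_cover :
    ∃ f : ℕ → EuclideanSpace ℝ (Fin m) → EuclideanSpace ℝ (Fin n),
      (∀ i, ∃ C : ℝ≥0, LipschitzWith C (f i)) ∧ μHE[m] (S \ ⋃ i, Set.range (f i)) = 0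

/-! A point at distance `r` from `K` has a nearest point `y` of `K`, and `y` lies on the frontier.
Cover the frontier by finitely many closed balls of radius `r`; each centre `c` owns the
`parallelPiece` of points with such a `y` in its ball. It suffices that a piece without `c` is a
1-Lipschitz image of a subset of the sphere of radius `2 * r`.

The map is the inverse of radial projection from `c`. Two points of a piece lie on spheres of radius
`r` whose closed balls contain `c`, and neither is strictly inside the other's sphere. By
`norm_smul_sub_smul_le` their distance is then at most `2 * r` times that of their directions. On a
circle of radius `r` through `c`, an angle θ at `c` cuts off an arc `2rθ`, so the constant is sharp.

Rectifiability follows because spheres are covered by finitely many Lipschitz images of a cube, and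
the inverse projection extends to a Lipschitz map. -/

/-! ### Angular estimate for points on spheres of equal radius -/

theorem norm_smul_sub_smul_sq {E : Type*} [NormedAddCommGroup E] [InnerProductSpace ℝ E]
    {u v : E} (hu : ‖u‖ = 1) (hv : ‖v‖ = 1) (a b : ℝ) :
    ‖a • u - b • v‖ ^ 2 = (b - a) ^ 2 + a * b * ‖u - v‖ ^ 2 := by
  rw [norm_sub_sq_real, norm_sub_sq_real, norm_smul, norm_smul, hu, hv, mul_one, mul_one,
    Real.norm_eq_abs, Real.norm_eq_abs, sq_abs, sq_abs, real_inner_smul_left,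
    real_inner_smul_right]
  ring

/-- The Gram inequality for a vector and two unit vectors that are not parallel. -/
theorem inner_sq_add_inner_sq_le {E : Type*} [NormedAddCommGroup E] [InnerProductSpace ℝ E]
    {u v : E} (hu : ‖u‖ = 1) (hv : ‖v‖ = 1) (y : E) (hk : 0 < 1 - inner ℝ u v ^ 2) :
    inner ℝ u y ^ 2 + inner ℝ v y ^ 2 - 2 * inner ℝ u v * inner ℝ u y * inner ℝ v y ≤
      ‖y‖ ^ 2 * (1 - inner ℝ u v ^ 2) := by
  set k := inner ℝ u v with hkdef
  set p := inner ℝ u y with hp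
  set q := inner ℝ v y with hq
  -- This vector is `1 - k ^ 2` times the residual of `y` after orthogonal projection to the span of
  -- `u` and `v`.
  have h : 0 ≤ ‖(1 - k ^ 2) • y - ((p - k * q) • u + (q - k * p) • v)‖ ^ 2 := sq_nonneg _
  have huu : inner ℝ u u = (1 : ℝ) := by rw [real_inner_self_eq_norm_sq, hu]; norm_num
  have hvv : inner ℝ v v = (1 : ℝ) := by rw [real_inner_self_eq_norm_sq, hv]; norm_num
  have hvu : inner ℝ v u = k := by rw [real_inner_comm]
  have hyu : inner ℝ y u = p := by rw [real_inner_comm]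
  have hyv : inner ℝ y v = q := by rw [real_inner_comm]
  rw [← real_inner_self_eq_norm_sq] at h
  simp only [inner_sub_left, inner_sub_right, inner_add_left, inner_add_right,
    real_inner_smul_left, real_inner_smul_right, huu, hvv, hvu, hyu, hyv, ← hkdef, ← hp, ← hq,
    real_inner_self_eq_norm_sq y] at h
  have h' : 0 ≤ (1 - k ^ 2) * (‖y‖ ^ 2 * (1 - k ^ 2) - (p ^ 2 + q ^ 2 - 2 * k * p * q)) := by
    linarith
  linarith [nonneg_of_mul_nonneg_right h' hk]

/-- In the variables `q - p` and `p + q` the Gram inequality is diagonal, with weights `2 + 2 * k`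
and `2 - 2 * k` that sum to 4. Cauchy–Schwarz with these weights bounds it through `f + g`, in which
`p`, known only by an inequality, cancels. -/
theorem sq_sub_le_of_gram {a b r k p q Y : ℝ} (ha : 0 < a) (hab : a ≤ b)
    (hYr : Y ≤ r ^ 2) (hk1 : -1 < k) (hk2 : k < 1) (e1 : b ^ 2 - 2 * b * q + Y = r ^ 2)
    (e2 : r ^ 2 ≤ a ^ 2 - 2 * a * p + Y)
    (hgram : p ^ 2 + q ^ 2 - 2 * k * p * q ≤ Y * (1 - k ^ 2)) :
    (b - a) ^ 2 ≤ (2 - 2 * k) * (4 * r ^ 2 - a * b) := by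
  have hb0 : 0 < b := ha.trans_le hab
  obtain ⟨t, ht⟩ : ∃ t, r ^ 2 - Y = t * b := ⟨(r ^ 2 - Y) / b, by field_simp⟩
  have ht0 : 0 ≤ t := by
    by_contra! h
    nlinarith
  have hq' : 2 * q = b - t := by
    have : b * (2 * q) = b * (b - t) := by linarith
    exact mul_left_cancel₀ hb0.ne' this
  have hp' : 2 * p ≤ a - t := by
    have : a * (2 * p) ≤ a * (a - t) := by nlinarith
    exact le_of_mul_le_mul_left this ha
  -- `f` is the slack in `b - a ≤ 2 * (q - p)`.
  obtain ⟨f, hf⟩ : ∃ f, f = 2 * (q - p) - (b - a) := ⟨_, rfl⟩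
  obtain ⟨g, hg⟩ : ∃ g, g = 2 * (p + q) := ⟨_, rfl⟩
  have hf0 : 0 ≤ f := by linarith
  have h1 : (2 * (q - p)) ^ 2 * (2 + 2 * k) + g ^ 2 * (2 - 2 * k) ≤
      4 * Y * ((2 - 2 * k) * (2 + 2 * k)) := by
    rw [hg]; linarith
  have h2 : (b - a) ^ 2 + f ^ 2 ≤ (2 * (q - p)) ^ 2 := by
    have : 2 * (q - p) = f + (b - a) := by rw [hf]; ring
    rw [this]; linarith [mul_nonneg hf0 (sub_nonneg.2 hab)]
  have h3 : (2 - 2 * k) * (2 + 2 * k) * ((f + g) ^ 2 / 4) ≤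
      f ^ 2 * (2 + 2 * k) + g ^ 2 * (2 - 2 * k) := by
    linarith [sq_nonneg (f * (2 + 2 * k) - g * (2 - 2 * k))]
  have h4 : f + g = a + b - 2 * t := by rw [hf, hg]; linarith
  have hV : 0 < 2 + 2 * k := by linarith
  have h5 : (2 + 2 * k) * (b - a) ^ 2 ≤
      (2 + 2 * k) * ((2 - 2 * k) * (4 * Y - (f + g) ^ 2 / 4)) := by
    linarith [mul_le_mul_of_nonneg_right h2 hV.le]
  refine (le_of_mul_le_mul_left h5 hV).trans ?_
  refine mul_le_mul_of_nonneg_left ?_ (by linarith)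
  rw [h4]
  linarith [mul_nonneg ht0 (sub_nonneg.2 hab), mul_nonneg ht0 hb0.le, sq_nonneg (a - b),
    sq_nonneg t]

/-- If `b • v` lies on a sphere of radius `r` whose closed ball contains the origin, and `a • u`
with `a ≤ b` is not inside that sphere, then the angle between `u` and `v` controls `b - a`. -/
theorem sq_sub_le_of_norm_sub_eq {E : Type*} [NormedAddCommGroup E] [InnerProductSpace ℝ E]
    {u v y : E} {a b r : ℝ} (hu : ‖u‖ = 1) (hv : ‖v‖ = 1) (ha : 0 < a) (hab : a ≤ b)
    (hy : ‖y‖ ≤ r) (hb : ‖b • v - y‖ = r) (hau : r ≤ ‖a • u - y‖) :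
    (b - a) ^ 2 ≤ ‖u - v‖ ^ 2 * (4 * r ^ 2 - a * b) := by
  have hb0 : 0 < b := ha.trans_le hab
  have hr : 0 ≤ r := (norm_nonneg y).trans hy
  have hW : ‖u - v‖ ^ 2 = 2 - 2 * inner ℝ u v := by
    rw [norm_sub_sq_real, hu, hv]; ring
  have hYr : ‖y‖ ^ 2 ≤ r ^ 2 := by gcongr
  have e1 : b ^ 2 - 2 * b * inner ℝ v y + ‖y‖ ^ 2 = r ^ 2 := by
    rw [← hb, norm_sub_sq_real, norm_smul, hv, real_inner_smul_left, mul_one, Real.norm_eq_abs,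
      sq_abs]
    ring
  have e2 : r ^ 2 ≤ a ^ 2 - 2 * a * inner ℝ u y + ‖y‖ ^ 2 := by
    have : r ^ 2 ≤ ‖a • u - y‖ ^ 2 := by gcongr
    rw [norm_sub_sq_real, norm_smul, hu, real_inner_smul_left, mul_one, Real.norm_eq_abs,
      sq_abs] at this
    linarith
  have hkabs : |inner ℝ u v| ≤ 1 := by
    have := abs_real_inner_le_norm u v
    rwa [hu, hv, mul_one] at this
  obtain ⟨hk1, hk2⟩ := abs_le.1 hkabs
  have hb2r : b ≤ 2 * r := by
    have : ‖b • v‖ ≤ ‖b • v - y‖ + ‖y‖ := by simpa using norm_add_le (b • v - y) y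
    rw [norm_smul, hv, mul_one, Real.norm_of_nonneg hb0.le] at this
    linarith
  rw [hW]
  -- The Gram determinant vanishes for parallel `u` and `v`. Opposite directions only need `a + b ≤
  -- 4 * r`; equal directions force `a = b`, since the ray leaves the ball only once.
  rcases hk1.eq_or_lt with hk1 | hk1
  · rw [← hk1]
    have : (a + b) ^ 2 ≤ (4 * r) ^ 2 := by gcongr; linarith
    linarith
  rcases hk2.eq_or_lt with hk2 | hk2
  · obtain rfl : u = v := (inner_eq_one_iff_of_norm_eq_one (𝕜 := ℝ) hu hv).1 hk2
    have h0 : (b - a) * (r ^ 2 - ‖y‖ ^ 2 + a * b) ≤ 0 := by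
      linarith [mul_le_mul_of_nonneg_left e2 hb0.le, congrArg (a * ·) e1]
    have : b - a ≤ 0 := by
      by_contra! h
      have : 0 < (b - a) * (r ^ 2 - ‖y‖ ^ 2 + a * b) := by
        have := mul_pos ha hb0
        exact mul_pos h (by linarith)
      linarith
    have : b = a := by linarith
    rw [hk2, this]; simp
  exact sq_sub_le_of_gram ha hab hYr hk1 hk2 e1 e2
    (inner_sq_add_inner_sq_le hu hv y (by nlinarith))

/-- Radial projection onto the unit sphere shrinks distances by a factor at most `2 * r` on the
outer boundary of a union of closed balls of radius `r` containing the origin. -/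
theorem norm_smul_sub_smul_le {E : Type*} [NormedAddCommGroup E] [InnerProductSpace ℝ E]
    {u v y z : E} {a b r : ℝ} (hu : ‖u‖ = 1) (hv : ‖v‖ = 1) (ha : 0 < a) (hb : 0 < b)
    (hy : ‖y‖ ≤ r) (hz : ‖z‖ ≤ r) (hau : ‖a • u - z‖ = r) (hbv : ‖b • v - y‖ = r)
    (hay : r ≤ ‖a • u - y‖) (hbz : r ≤ ‖b • v - z‖) :
    ‖a • u - b • v‖ ≤ 2 * r * ‖u - v‖ := by
  have hr : 0 ≤ r := (norm_nonneg y).trans hy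
  refine le_of_sq_le_sq ?_ (by positivity)
  rw [norm_smul_sub_smul_sq hu hv, mul_pow]
  rcases le_total a b with h | h
  · nlinarith [sq_sub_le_of_norm_sub_eq hu hv ha h hy hbv hay]
  · have := sq_sub_le_of_norm_sub_eq hv hu hb h hz hau hbz
    rw [norm_sub_rev v u] at this
    nlinarith

/-! ### Lipschitz images and Hausdorff measure -/

theorem LipschitzOnWith.euclideanHausdorffMeasure_image_le {X Y : Type*}
    [EMetricSpace X] [MeasurableSpace X] [BorelSpace X]
    [EMetricSpace Y] [MeasurableSpace Y] [BorelSpace Y] {C : ℝ≥0} {f : X → Y} {s : Set X}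
    (h : LipschitzOnWith C f s) (d : ℕ) :
    μHE[d] (f '' s) ≤ (C : ℝ≥0∞) ^ d * μHE[d] s := by
  simp only [Measure.euclideanHausdorffMeasure_def, Measure.smul_apply]
  have := h.hausdorffMeasure_image_le (d := d) (by positivity)
  rw [ENNReal.rpow_natCast] at this
  calc _ ≤ _ := smul_le_smul_of_nonneg_left this zero_le
    _ = _ := by rw [mul_smul_comm]

/-- The part of a piece of the parallel surface lying over a ball is a nonexpanding image of a
subset of the sphere of twice the radius. -/
theorem exists_lipschitzOnWith_sphere {E : Type*} [NormedAddCommGroup E] [InnerProductSpace ℝ E]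
    {S : Set E} {c : E} {r : ℝ} (hr : 0 < r) (hc : c ∉ S)
    (hS : ∀ x ∈ S, ∃ y, dist y c ≤ r ∧ dist x y = r ∧ ∀ x' ∈ S, r ≤ dist x' y) :
    ∃ T ⊆ Metric.sphere (0 : E) (2 * r), ∃ F : E → E, LipschitzOnWith 1 F T ∧ F '' T = S := by
  have hpos : ∀ x ∈ S, 0 < ‖x - c‖ := fun x hx ↦
    norm_pos_iff.2 (sub_ne_zero.2 (ne_of_mem_of_not_mem hx hc))
  have hunit : ∀ x ∈ S, ‖‖x - c‖⁻¹ • (x - c)‖ = 1 := fun x hx ↦ by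
    rw [norm_smul, norm_inv, norm_norm, inv_mul_cancel₀ (hpos x hx).ne']
  have hsmul : ∀ x ∈ S, ‖x - c‖ • ‖x - c‖⁻¹ • (x - c) = x - c := fun x hx ↦ by
    rw [smul_smul, mul_inv_cancel₀ (hpos x hx).ne', one_smul]
  -- Rescaling to radius `2 * r` absorbs the constant of the angular estimate, so `G` does not
  -- decrease distances.
  let G : E → E := fun x ↦ (2 * r) • ‖x - c‖⁻¹ • (x - c)
  have hG : ∀ x ∈ S, ∀ x' ∈ S, dist x x' ≤ dist (G x) (G x') := by
    intro x hx x' hx'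
    obtain ⟨z, hz, hxz, hz'⟩ := hS x hx
    obtain ⟨y, hy, hxy, hy'⟩ := hS x' hx'
    have key := norm_smul_sub_smul_le (y := y - c) (z := z - c) (r := r) (hunit x hx)
      (hunit x' hx') (hpos x hx) (hpos x' hx') (by rwa [← dist_eq_norm])
      (by rwa [← dist_eq_norm])
    rw [hsmul x hx, hsmul x' hx'] at key
    simp only [sub_sub_sub_cancel_right, ← dist_eq_norm] at key
    refine (key hxz hxy (hy' x hx) (hz' x' hx')).trans_eq ?_
    rw [dist_smul₀, Real.norm_of_nonneg (by positivity), dist_eq_norm x c, dist_eq_norm x' c]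
  have hinj : Set.InjOn G S := fun x hx x' hx' h ↦
    dist_le_zero.1 ((hG x hx x' hx').trans_eq (by rw [h, dist_self]))
  have hleft := hinj.leftInvOn_invFunOn
  refine ⟨G '' S, ?_, Function.invFunOn G S, ?_, hleft.image_image⟩
  · rintro _ ⟨x, hx, rfl⟩
    rw [mem_sphere_zero_iff_norm, norm_smul, hunit x hx, mul_one,
      Real.norm_of_nonneg (by positivity)]
  · refine LipschitzOnWith.of_dist_le_mul ?_
    rintro _ ⟨x, hx, rfl⟩ _ ⟨x', hx', rfl⟩
    rw [hleft hx, hleft hx', NNReal.coe_one, one_mul]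
    exact hG x hx x' hx'

/-- `S` is covered by the images of a bounded subset of `ℝ^m` under finitely many Lipschitz
maps. -/
def IsLipschitzCoverable {X : Type*} [PseudoEMetricSpace X] (m : ℕ) (S : Set X) : Prop :=
  ∃ t : Set (EuclideanSpace ℝ (Fin m) → X), t.Finite ∧ (∀ f ∈ t, ∃ C : ℝ≥0, LipschitzWith C f) ∧
    ∃ B : Set (EuclideanSpace ℝ (Fin m)), Bornology.IsBounded B ∧ S ⊆ ⋃ f ∈ t, f '' B

namespace IsLipschitzCoverable

theorem mono {X : Type*} [PseudoEMetricSpace X] {m : ℕ} {S S' : Set X}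
    (h : IsLipschitzCoverable m S') (hS : S ⊆ S') : IsLipschitzCoverable m S := by
  obtain ⟨t, ht, hf, B, hB, hc⟩ := h
  exact ⟨t, ht, hf, B, hB, hS.trans hc⟩

theorem singleton {X : Type*} [PseudoEMetricSpace X] (m : ℕ) (x : X) :
    IsLipschitzCoverable m {x} :=
  ⟨{fun _ ↦ x}, Set.finite_singleton _, by rintro _ rfl; exact ⟨0, LipschitzWith.const x⟩, {0},
    Bornology.isBounded_singleton, by simp⟩

theorem biUnion {X ι : Type*} [PseudoEMetricSpace X] {m : ℕ} {I : Set ι} (hI : I.Finite)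
    {S : ι → Set X} (h : ∀ i ∈ I, IsLipschitzCoverable m (S i)) :
    IsLipschitzCoverable m (⋃ i ∈ I, S i) := by
  choose! t ht hf B hB hc using h
  refine ⟨⋃ i ∈ I, t i, hI.biUnion ht, ?_, ⋃ i ∈ I, B i, (Bornology.isBounded_biUnion hI).2 hB, ?_⟩
  · intro f hft
    obtain ⟨i, hi, hfi⟩ := Set.mem_iUnion₂.1 hft
    exact hf i hi f hfi
  · refine Set.iUnion₂_subset fun i hi x hx ↦ ?_
    obtain ⟨f, hft, hxf⟩ := Set.mem_iUnion₂.1 (hc i hi hx)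
    exact Set.mem_iUnion₂.2 ⟨f, Set.mem_biUnion hi hft,
      Set.image_mono (Set.subset_biUnion_of_mem hi) hxf⟩

theorem union {X : Type*} [PseudoEMetricSpace X] {m : ℕ} {S S' : Set X}
    (h : IsLipschitzCoverable m S) (h' : IsLipschitzCoverable m S') :
    IsLipschitzCoverable m (S ∪ S') := by
  rw [Set.union_eq_iUnion]
  simpa using biUnion (I := Set.univ) Set.finite_univ (S := fun b : Bool ↦ cond b S S')
    (by rintro (_ | _) _ <;> assumption)

theorem image {X Y : Type*} [PseudoEMetricSpace X] [PseudoEMetricSpace Y] {m : ℕ} {S : Set X}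
    (h : IsLipschitzCoverable m S) {C : ℝ≥0} {g : X → Y} (hg : LipschitzWith C g) :
    IsLipschitzCoverable m (g '' S) := by
  obtain ⟨t, ht, hf, B, hB, hc⟩ := h
  refine ⟨(g ∘ ·) '' t, ht.image _, ?_, B, hB, ?_⟩
  · rintro _ ⟨f, hft, rfl⟩
    obtain ⟨C', hC'⟩ := hf f hft
    exact ⟨_, hg.comp hC'⟩
  · rintro _ ⟨x, hx, rfl⟩
    obtain ⟨f, hft, y, hy, rfl⟩ := Set.mem_iUnion₂.1 (hc hx)
    exact Set.mem_iUnion₂.2 ⟨_, ⟨f, hft, rfl⟩, y, hy, rfl⟩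

theorem measure_lt_top {X : Type*} [EMetricSpace X] [MeasurableSpace X] [BorelSpace X] {m : ℕ}
    {S : Set X} (h : IsLipschitzCoverable m S) : μHE[m] S < ∞ := by
  obtain ⟨t, ht, hf, B, hB, hc⟩ := h
  refine (measure_mono hc).trans_lt (measure_biUnion_lt_top ht fun f hft ↦ ?_)
  obtain ⟨C, hC⟩ := hf f hft
  refine (hC.lipschitzOnWith.euclideanHausdorffMeasure_image_le m).trans_lt ?_
  rw [EuclideanSpace.euclideanHausdorffMeasure_eq_volume]
  exact ENNReal.mul_lt_top (ENNReal.pow_lt_top ENNReal.coe_lt_top) hB.measure_lt_top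

theorem isHausdorffRectifiable {n m : ℕ} {S : Set (EuclideanSpace ℝ (Fin n))}
    (h : IsLipschitzCoverable m S) (hS : MeasurableSet S) : IsHausdorffRectifiable m S := by
  refine ⟨hS.nullMeasurableSet, h.measure_lt_top, ?_⟩
  obtain ⟨t, ht, hf, B, hB, hc⟩ := h
  -- The added constant map keeps the family nonempty, so that a sequence can enumerate it.
  obtain ⟨f, hft⟩ := (ht.insert (fun _ ↦ 0)).countable.exists_eq_range (Set.insert_nonempty _ _)
  refine ⟨f, fun i ↦ ?_, ?_⟩
  · rcases (hft ▸ Set.mem_range_self i : f i ∈ insert (fun _ ↦ 0) t) with h0 | h0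
    · exact ⟨0, h0 ▸ LipschitzWith.const _⟩
    · exact hf _ h0
  · rw [Set.sdiff_eq_empty.2, measure_empty]
    intro x hx
    obtain ⟨g, hg, y, -, rfl⟩ := Set.mem_iUnion₂.1 (hc hx)
    obtain ⟨i, rfl⟩ : g ∈ Set.range f := hft ▸ Set.mem_insert_of_mem _ hg
    exact Set.mem_iUnion.2 ⟨i, y, rfl⟩

end IsLipschitzCoverable

/-! ### Covering a sphere by Lipschitz images of a cube -/

/-- Radial projection to the unit sphere is nonexpanding outside the unit ball. -/
theorem lipschitzOnWith_inv_norm_smul {E : Type*} [NormedAddCommGroup E]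
    [InnerProductSpace ℝ E] : LipschitzOnWith 1 (fun x : E ↦ ‖x‖⁻¹ • x) {x | 1 ≤ ‖x‖} := by
  refine LipschitzOnWith.of_dist_le_mul fun x (hx : 1 ≤ ‖x‖) y (hy : 1 ≤ ‖y‖) ↦ ?_
  rw [NNReal.coe_one, one_mul, dist_eq_norm, dist_eq_norm]
  have hunit : ∀ z : E, 1 ≤ ‖z‖ → ‖‖z‖⁻¹ • z‖ = 1 := fun z hz ↦ by
    rw [norm_smul, norm_inv, norm_norm, inv_mul_cancel₀ (by positivity)]
  have hsmul : ∀ z : E, 1 ≤ ‖z‖ → ‖z‖ • ‖z‖⁻¹ • z = z := fun z hz ↦ by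
    rw [smul_smul, mul_inv_cancel₀ (by positivity), one_smul]
  have h := norm_smul_sub_smul_sq (hunit x hx) (hunit y hy) ‖x‖ ‖y‖
  rw [hsmul x hx, hsmul y hy] at h
  refine le_of_sq_le_sq ?_ (norm_nonneg _)
  rw [h]
  have hxy : 1 ≤ ‖x‖ * ‖y‖ := one_le_mul_of_one_le_of_one_le hx hy
  nlinarith [sq_nonneg (‖y‖ - ‖x‖), sq_nonneg ‖‖x‖⁻¹ • x - ‖y‖⁻¹ • y‖]

theorem EuclideanSpace.isometry_insertNth {m : ℕ} (i : Fin (m + 1)) (s : ℝ) :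
    Isometry fun x : EuclideanSpace ℝ (Fin m) ↦
      (WithLp.toLp 2 (i.insertNth s x.ofLp) : EuclideanSpace ℝ (Fin (m + 1))) := by
  refine Isometry.of_dist_eq fun x y ↦ ?_
  rw [EuclideanSpace.dist_eq, EuclideanSpace.dist_eq, Fin.sum_univ_succAbove _ i]
  simp

/-- A sphere is covered by the radial projections of the faces of a cube. -/
theorem isLipschitzCoverable_sphere (m : ℕ) {ρ : ℝ} (hρ : 0 < ρ) :
    IsLipschitzCoverable m (Metric.sphere (0 : EuclideanSpace ℝ (Fin (m + 1))) ρ) := by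
  let face (i : Fin (m + 1)) (s : ℝ) (x : EuclideanSpace ℝ (Fin m)) :
    EuclideanSpace ℝ (Fin (m + 1)) := WithLp.toLp 2 (i.insertNth s x.ofLp)
  let g (i : Fin (m + 1)) (s : ℝ) (x : EuclideanSpace ℝ (Fin m)) :
    EuclideanSpace ℝ (Fin (m + 1)) := ρ • ‖face i s x‖⁻¹ • face i s x
  refine ⟨Set.image2 g Set.univ {1, -1}, Set.finite_univ.image2 _ (Set.toFinite _), ?_,
    {x | ∀ j, |x j| ≤ 1}, ?_, ?_⟩
  · rintro _ ⟨i, -, s, hs, rfl⟩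
    have hs1 : |s| = 1 := by rcases hs with rfl | rfl <;> simp
    have hface : ∀ x, 1 ≤ ‖face i s x‖ := fun x ↦ by
      simpa [face, hs1] using PiLp.norm_apply_le (face i s x) i
    have := lipschitzOnWith_inv_norm_smul.comp
      (EuclideanSpace.isometry_insertNth i s).lipschitz.lipschitzOnWith
      (s := Set.univ) (fun x _ ↦ hface x)
    exact ⟨_, (lipschitzWith_smul ρ).comp (lipschitzOnWith_univ.1 this)⟩
  · refine (Metric.isBounded_iff_subset_closedBall 0).2 ⟨√m, fun x hx ↦ ?_⟩
    rw [mem_closedBall_zero_iff, EuclideanSpace.norm_eq]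
    refine Real.sqrt_le_sqrt ?_
    calc ∑ j, ‖x j‖ ^ 2 ≤ ∑ j : Fin m, (1 : ℝ) :=
          Finset.sum_le_sum fun j _ ↦ pow_le_one₀ (norm_nonneg _) (hx j)
      _ = m := by simp
  · intro u hu
    rw [mem_sphere_zero_iff_norm] at hu
    -- The coordinate of largest modulus selects the face hit by the ray through `u`.
    obtain ⟨i, hi⟩ := Finite.exists_max fun j ↦ |u j|
    have hi0 : 0 < |u i| := by
      by_contra! h
      have : u = 0 := by
        ext j
        exact abs_nonpos_iff.1 ((hi j).trans h)
      rw [this, norm_zero] at hu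
      exact hρ.ne hu
    let x : EuclideanSpace ℝ (Fin m) := WithLp.toLp 2 fun j ↦ |u i|⁻¹ * u (i.succAbove j)
    have hx : face i (|u i|⁻¹ * u i) x = |u i|⁻¹ • u := by
      ext j
      refine Fin.succAboveCases i ?_ (fun j ↦ ?_) j <;> simp [face, x]
    refine Set.mem_iUnion₂.2 ⟨g i (|u i|⁻¹ * u i), ⟨i, Set.mem_univ _, _, ?_, rfl⟩, x, ?_, ?_⟩
    · rcases abs_cases (u i) with ⟨h, -⟩ | ⟨h, -⟩
      · left
        rw [h, inv_mul_cancel₀ (h ▸ hi0.ne')]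
      · right
        have : u i ≠ 0 := abs_pos.1 hi0
        rw [h, Set.mem_singleton_iff]
        field_simp
    · intro j
      simp only [x, abs_mul, abs_inv, abs_abs]
      rw [inv_mul_le_iff₀ hi0, mul_one]
      exact hi _
    · simp only [g, hx, norm_smul, norm_inv, Real.norm_eq_abs, abs_abs, hu, smul_smul]
      rw [show ρ * (|u i|⁻¹ * ρ)⁻¹ * |u i|⁻¹ = 1 by field_simp, one_smul]

/-! ### Covering the parallel surface -/

theorem Metric.exists_finite_isCover_encard_eq_externalCoveringNumber {X : Type*}
    [PseudoEMetricSpace X] {ε : ℝ≥0} {A : Set X} (hε : ε ≠ 0) (hA : TotallyBounded A) :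
    ∃ C : Set X, C.Finite ∧ Metric.IsCover ε A C ∧
      C.encard = Metric.externalCoveringNumber ε A := by
  obtain ⟨C₀, -, hC₀, hC₀A⟩ := Metric.exists_finite_isCover_of_totallyBounded hε hA
  have : Nonempty {C : Set X // Metric.IsCover ε A C} := ⟨C₀, hC₀A⟩
  obtain ⟨C, hC⟩ := ENat.exists_eq_iInf
    fun C : {C : Set X // Metric.IsCover ε A C} ↦ (C : Set X).encard
  have hC' : (C : Set X).encard = Metric.externalCoveringNumber ε A := by
    rw [hC, iInf_subtype]
    rfl
  refine ⟨C, ?_, C.2, hC'⟩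
  rw [← Set.encard_lt_top_iff, hC']
  exact hC₀A.externalCoveringNumber_le_encard.trans_lt hC₀.encard_lt_top

theorem frontier_thickening_eq {E : Type*} [NormedAddCommGroup E] [NormedSpace ℝ E] (K : Set E)
    {r : ℝ} (hr : 0 < r) :
    frontier (Metric.thickening r K) = {x | Metric.infDist x K = r} := by
  rcases K.eq_empty_or_nonempty with rfl | hne
  -- `Metric.infDist` to the empty set is 0, hence never `r`.
  · simp [hr.ne]
  ext x
  have hc : x ∈ Metric.cthickening r K ↔ Metric.infDist x K ≤ r := by
    rw [Metric.mem_cthickening_iff, Metric.infDist,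
      ENNReal.le_ofReal_iff_toReal_le (Metric.infEDist_ne_top hne) hr.le]
  rw [Metric.isOpen_thickening.frontier_eq, closure_thickening hr, Set.mem_sdiff, hc,
    Metric.mem_thickening_iff_infDist_lt hne, not_lt, Set.mem_ofPred_eq, le_antisymm_iff]

/-- The points at distance `r` from `K` having a nearest point in the closed ball of radius `r`
around `c`. -/
def parallelPiece {E : Type*} [PseudoMetricSpace E] (K : Set E) (r : ℝ) (c : E) : Set E :=
  {x | Metric.infDist x K = r ∧ ∃ y ∈ K, dist x y = r ∧ dist y c ≤ r}

theorem setOf_infDist_eq_subset_biUnion_parallelPiece {E : Type*} [NormedAddCommGroup E]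
    [NormedSpace ℝ E] [FiniteDimensional ℝ E] {K C : Set E} (hK : IsClosed K) {r : ℝ} (hr : 0 < r)
    (hC : Metric.IsCover r.toNNReal (frontier K) C) :
    {x | Metric.infDist x K = r} ⊆ ⋃ c ∈ C, parallelPiece K r c := by
  intro x (hx : Metric.infDist x K = r)
  have hne : K ≠ ∅ := by
    rintro rfl
    simp [hr.ne] at hx
  have hxK : x ∈ Kᶜ := fun h ↦ hr.ne' (hx ▸ Metric.infDist_zero_of_mem h)
  obtain ⟨y, hy, hxy⟩ := exists_mem_frontier_infDist_compl_eq_dist hxK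
    (Set.compl_ne_univ.2 (Set.nonempty_iff_ne_empty.2 hne))
  rw [compl_compl, hx] at hxy
  rw [frontier_compl] at hy
  obtain ⟨c, hc, hyc⟩ := hC hy
  refine Set.mem_iUnion₂.2 ⟨c, hc, hx, y, hK.frontier_subset hy, hxy.symm, ?_⟩
  have hyc : edist y c ≤ ENNReal.ofReal r := hyc
  rwa [edist_dist, ENNReal.ofReal_le_ofReal_iff hr.le] at hyc

theorem exists_lipschitzOnWith_parallelPiece {E : Type*} [NormedAddCommGroup E]
    [InnerProductSpace ℝ E] (K : Set E) {r : ℝ} (hr : 0 < r) (c : E) :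
    ∃ T ⊆ Metric.sphere (0 : E) (2 * r), ∃ F : E → E,
      LipschitzOnWith 1 F T ∧ F '' T = parallelPiece K r c \ {c} := by
  refine exists_lipschitzOnWith_sphere hr (fun h ↦ h.2 rfl) ?_
  rintro x ⟨⟨-, y, hyK, hxy, hyc⟩, -⟩
  exact ⟨y, hyc, hxy, fun x' hx' ↦ hx'.1.1.symm.le.trans (Metric.infDist_le_dist_of_mem hyK)⟩

theorem isLipschitzCoverable_parallelPiece {m : ℕ} (K : Set (EuclideanSpace ℝ (Fin (m + 1))))
    {r : ℝ} (hr : 0 < r) (c : EuclideanSpace ℝ (Fin (m + 1))) :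
    IsLipschitzCoverable m (parallelPiece K r c) := by
  obtain ⟨T, hT, F, hF, hFT⟩ := exists_lipschitzOnWith_parallelPiece K hr c
  -- The extension may have a larger Lipschitz constant, which is harmless here; the measure bound
  -- uses `F` on `T` itself.
  obtain ⟨G, hG, hGF⟩ := hF.extend_finite_dimension
  have hcover := (((isLipschitzCoverable_sphere m (by positivity)).mono hT).image hG).union
    (IsLipschitzCoverable.singleton m c)
  rw [← hGF.image_eq, hFT] at hcover
  exact hcover.mono fun x hx ↦ (em (x = c)).symm.imp (fun h ↦ ⟨hx, h⟩) id

theorem euclideanHausdorffMeasure_parallelPiece_le {m : ℕ} (hm : m ≠ 0)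
    (K : Set (EuclideanSpace ℝ (Fin (m + 1)))) {r : ℝ} (hr : 0 < r)
    (c : EuclideanSpace ℝ (Fin (m + 1))) :
    μHE[m] (parallelPiece K r c) ≤ sphereArea m (2 * r) := by
  obtain ⟨T, hT, F, hF, hFT⟩ := exists_lipschitzOnWith_parallelPiece K hr c
  -- The centre may belong to the piece; it is negligible only because `m ≠ 0`, which is where `2 ≤
  -- n` enters.
  have hnull : μHE[m] ({c} : Set (EuclideanSpace ℝ (Fin (m + 1)))) = 0 := by
    refine (Measure.euclideanHausdorffMeasure_zero_or_top (Nat.pos_of_ne_zero hm) {c}).resolve_right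
      ?_
    simp
  rw [← measure_sdiff_null hnull, ← hFT]
  refine (hF.euclideanHausdorffMeasure_image_le m).trans ?_
  rw [ENNReal.coe_one, one_pow, one_mul]
  exact measure_mono hT

theorem mainTheorem3 (n : ℕ) (hn : 1 ≤ n) (K : Set (EuclideanSpace ℝ (Fin n)))
    (hK : IsCompact K) (r : ℝ) (hr : 0 < r) :
    frontier (Metric.thickening r K) = {x | Metric.infDist x K = r} ∧
    IsHausdorffRectifiable (n - 1) {x | Metric.infDist x K = r} ∧
    (2 ≤ n →
      μHE[n - 1] {x | Metric.infDist x K = r} ≤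
        (Metric.externalCoveringNumber r.toNNReal (frontier K) : ℝ≥0∞) *
          sphereArea (n - 1) (2 * r)) := by
  obtain ⟨m, rfl⟩ : ∃ m, n = m + 1 := ⟨n - 1, by omega⟩
  obtain ⟨C, hCfin, hCcov, hCcard⟩ :=
    Metric.exists_finite_isCover_encard_eq_externalCoveringNumber
      (Real.toNNReal_pos.2 hr).ne'
      (hK.of_isClosed_subset isClosed_frontier hK.isClosed.frontier_subset).totallyBounded
  have hsub := setOf_infDist_eq_subset_biUnion_parallelPiece hK.isClosed hr hCcov
  rw [Nat.add_sub_cancel]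
  refine ⟨frontier_thickening_eq K hr, ?_, fun hm ↦ ?_⟩
  · refine ((IsLipschitzCoverable.biUnion hCfin fun c _ ↦
      isLipschitzCoverable_parallelPiece K hr c).mono hsub).isHausdorffRectifiable ?_
    exact (isClosed_eq (Metric.continuous_infDist_pt K) continuous_const).measurableSet
  · have hcard : (Metric.externalCoveringNumber r.toNNReal (frontier K) : ℝ≥0∞) =
        hCfin.toFinset.card := by
      rw [← hCcard, hCfin.encard_eq_coe_toFinset_card, ENat.toENNReal_coe]
    calc μHE[m] {x | Metric.infDist x K = r}
        ≤ μHE[m] (⋃ c ∈ hCfin.toFinset, parallelPiece K r c) :=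
          measure_mono (hsub.trans (by simp))
      _ ≤ ∑ c ∈ hCfin.toFinset, μHE[m] (parallelPiece K r c) := measure_biUnion_finset_le _ _
      _ ≤ ∑ c ∈ hCfin.toFinset, sphereArea m (2 * r) :=
          Finset.sum_le_sum fun c _ ↦ euclideanHausdorffMeasure_parallelPiece_le (by omega) K hr c
      _ = _ := by rw [Finset.sum_const, nsmul_eq_mul, hcard]
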